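/- Let $G=(V,E)$ be a locally finite, connected, undirected simple graph, write $v\sim w$ if $\{v,w\}\in E$, let $v_0\in V$ and let $\beta\in(0,\infty)$. The Ant RW on $G$ with strength of reinforcement $\beta$ started at $v_0$ is the $V$-valued process $(X_n)_{n\ge 0}$ with $X_0=v_0$ such that, for every $n\ge 0$ and every $x\in V$, almost surely $$\mathbb P(X_{n+1}=x\mid X_0,\dots,X_n)=\frac{\exp\{\beta\,c_n(X_n,x)\}}{\sum_{y\sim X_n}\exp\{\beta\,c_n(X_n,y)\}}\quad\text{if } x\sim X_n,$$ and $\mathbb P(X_{n+1}=x\mid X_0,\dots,X_n)=0$ otherwise, where $$c_n(x,y)=\sum_{k=0}^{n-1}\Big(\mathbf 1[(X_k,X_{k+1})=(x,y)]-\mathbf 1[(X_k,X_{k+1})=(y,x)]\Big)$$ is the net number of crossings of the directed edge $(x,y)$ up to time $n$. A circuit of $G$ is a finite sequence $C=(u_0,\dots,u_{\ell-1})$ of $\ell\ge 3$ pairwise distinct vertices with $u_i\sim u_{i+1}$ for $0\le i<\ell-1$ and $u_{\ell-1}\sim u_0$. Let $\mathscr C$ be the set of circuits of $G$ and, for $C=(u_0,\dots,u_{\ell-1})\in\mathscr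 C$, let $$T^C=\bigcup_{m\ge 0}\big\{X_{m+i}=u_{i \bmod \ell}\ \text{ for all } i\ge 0\big\}$$ be the event that the walk is eventually trapped in $C$, which it then follows forever. **Theorem 2.1.** Let $(X_n)_{n\ge0}$ be the Ant RW with any strength of reinforcement $\beta\in(0,\infty)$, started at any vertex of $G$, where either (a) $G$ is connected, finite and not a tree, or (b) $G=\mathbb Z^d$ with $d\ge 2$ (with edges between points at $\ell^1$-distance $1$). Then $$\mathbb P\Big(\bigcup_{C\in\mathscr C}T^C\Big)=1 .$$ -/

import Mathlib

open MeasureTheory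

noncomputable section

namespace AntRW

/-- The net crossing number `c_n(x,y)` of a path `p`: the number of jumps from `x` to `y` minus the
number of jumps from `y` to `x` among the first `n` steps of `p`. -/
def crossing {V : Type*} (p : ℕ → V) (n : ℕ) (x y : V) : ℤ :=
  open Classical in
  ∑ k ∈ Finset.range n,
    ((if (p k, p (k + 1)) = (x, y) then 1 else 0) - (if (p k, p (k + 1)) = (y, x) then 1 else 0))

/-- The weight `a_n(x,y) = exp (β c_n(x,y))`. -/
def weight {V : Type*} (β : ℝ) (p : ℕ → V) (n : ℕ) (x y : V) : ℝ :=
  Real.exp (β * (crossing p n x y : ℝ))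

/-- The probability with which a walker that has followed `p` up to time `n` jumps to `x`: it is
`a_n(p n, x) / ∑_{y ∼ p n} a_n(p n, y)` if `x` is a neighbour of `p n`, and `0` otherwise. -/
def stepProb {V : Type*} (G : SimpleGraph V) [G.LocallyFinite] (β : ℝ) (p : ℕ → V) (n : ℕ)
    (x : V) : ℝ :=
  open Classical in
  if G.Adj (p n) x then
    weight β p n (p n) x / ∑ y ∈ G.neighborFinset (p n), weight β p n (p n) y
  else 0

/-- The σ-algebra `σ(X_0, …, X_n)` (every subset of the countable state space is measurable). -/
abbrev history {Ω V : Type*} (X : ℕ → Ω → V) (n : ℕ) : MeasurableSpace Ω :=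
  ⨆ k ∈ Finset.range (n + 1), MeasurableSpace.comap (X k) ⊤

/-- `X` is, under `P`, an Ant RW on `G` with strength of reinforcement `β`, started at `v`. -/
structure IsAntRW {Ω V : Type*} [MeasurableSpace Ω] (G : SimpleGraph V) [G.LocallyFinite]
    (β : ℝ) (v : V) (P : Measure Ω) (X : ℕ → Ω → V) : Prop where
  measurable : ∀ n, Measurable[_, ⊤] (X n)
  start : ∀ᵐ ω ∂P, X 0 ω = v
  step : ∀ (n : ℕ) (x : V),
    P[Set.indicator {ω | X (n + 1) ω = x} (fun _ => (1 : ℝ)) | history X n]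
      =ᵐ[P] fun ω => stepProb G β (fun k => X k ω) n x

/-- A rooted directed circuit `(u_0, …, u_{ℓ-1})` of `G`: distinct vertices, each adjacent to the
next one and the last one adjacent to the first. The length is at least `3`, so that crossing one
edge back and forth is not a circuit (a tree has no circuit). -/
structure Circuit {V : Type*} (G : SimpleGraph V) where
  len : ℕ
  three_le_len : 3 ≤ len
  vert : Fin len → V
  injective : Function.Injective vert
  adj : ∀ i : Fin len,
    G.Adj (vert i) (vert ⟨(i.val + 1) % len, Nat.mod_lt _ (by omega)⟩)

/-- The event `T_m^C` that from time `m` on the walk spins around `C`, beginning at its root. -/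
def trappedAt {Ω V : Type*} {G : SimpleGraph V} (X : ℕ → Ω → V) (C : Circuit G) (m : ℕ) : Set Ω :=
  {ω | ∀ i : ℕ, X (m + i) ω = C.vert ⟨i % C.len, Nat.mod_lt _ (by have := C.three_le_len; omega)⟩}

/-- The event `T^C` that the walk is eventually trapped in `C`. -/
def trapped {Ω V : Type*} {G : SimpleGraph V} (X : ℕ → Ω → V) (C : Circuit G) : Set Ω :=
  ⋃ m : ℕ, trappedAt X C m

/-- The nearest-neighbour graph on `ℤ^d`: two points are adjacent iff their `ℓ¹` distance is `1`. -/
def lattice (d : ℕ) : SimpleGraph (Fin d → ℤ) where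
  Adj x y := ∑ i, |x i - y i| = 1
  symm := ⟨fun x y h => by simpa only [abs_sub_comm] using h⟩
  loopless := ⟨fun x h => by simp at h⟩

theorem lattice_neighborSet_finite (d : ℕ) (x : Fin d → ℤ) :
    ((lattice d).neighborSet x).Finite := by
  refine (Set.finite_Icc (fun i => x i - 1) (fun i => x i + 1)).subset fun y hy => ?_
  have hs : ∑ i, |x i - y i| = 1 := hy
  have h : ∀ i, |x i - y i| ≤ 1 := fun i =>
    hs ▸ Finset.single_le_sum (f := fun i => |x i - y i|) (fun j _ => abs_nonneg _)
      (Finset.mem_univ i)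
  refine ⟨fun i => ?_, fun i => ?_⟩ <;> have := abs_le.1 (h i) <;> simp only <;> omega

instance instLocallyFiniteLattice (d : ℕ) : (lattice d).LocallyFinite :=
  fun x => (lattice_neighborSet_finite d x).fintype

end AntRW

end

/-!
Let `c` be the net crossings up to time `n`. A step along an edge whose value of `c` leads the values
of the other edges at its tail by `θ` has probability at least `exp (-D exp (-β θ))`, where `D` bounds
the degrees. While the walk spins around a circuit, each turn increases by one the lead of every edge
of the circuit, and the product of these bounds converges. Hence a continuation that reaches a circuit
in boundedly many steps and then spins around it, using only edges whose value is within a bounded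
distance of the maximum at their tails, is followed forever with probability bounded below
(`IsAntRW.followBound_mul_le_trapped`). By Lévy's zero-one law it then suffices to find such
continuations at infinitely many times (`ae_mem_of_frequently`).

If the walk stays in a finite set `B`, they exist at all times, uniformly (`exists_spinning_path`).
The values `c x y` form a unit flow supported in `B`. Take a scale which none of the finitely many
values `|c x y|` comes close to from above (`exists_scale_gap`). Balance of the flow implies that a
vertex on an edge with a large value has an outgoing edge with a large value; following the maximal
outgoing edge from there, one only meets such vertices, never backtracks as `c` is antisymmetric, and
so ends in a circuit. Around all other vertices the values are small and any edge may be taken: the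
walk goes to the nearest vertex on an edge with a large value or, if there are none, to a circuit that
exists because the graph is not a tree. Thus the walk is almost surely trapped if its range is finite.

On `ℤ^d` a walk with infinite range exceeds infinitely often its past in one of the `2 d` coordinate
directions (`finite_range_of_eventually_not_record`). At such a time it has an unvisited half-space in
front of it, where it is trapped in a unit square with probability bounded below
(`IsAntRW.ae_trapped_of_frequently_record`).
-/

noncomputable section

namespace AntRW

/-! ### Net crossings -/

section Crossing

variable {V : Type*}

theorem crossing_zero (p : ℕ → V) (x y : V) : crossing p 0 x y = 0 := by
  simp [crossing]

open Classical in
theorem crossing_succ (p : ℕ → V) (n : ℕ) (x y : V) :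
    crossing p (n + 1) x y = crossing p n x y +
      ((if p n = x ∧ p (n + 1) = y then 1 else 0) -
        (if p n = y ∧ p (n + 1) = x then 1 else 0)) := by
  simp only [crossing, Finset.sum_range_succ, Prod.mk.injEq]

theorem crossing_congr {p q : ℕ → V} {n : ℕ} (h : ∀ k ≤ n, p k = q k) (x y : V) :
    crossing p n x y = crossing q n x y := by
  unfold crossing
  refine Finset.sum_congr rfl fun k hk => ?_
  have hk := Finset.mem_range.1 hk
  rw [h k hk.le, h (k + 1) hk]

theorem crossing_antisymm (p : ℕ → V) (n : ℕ) (x y : V) :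
    crossing p n y x = -crossing p n x y := by
  induction n with
  | zero => simp [crossing_zero]
  | succ n ih => rw [crossing_succ, crossing_succ, ih]; ring

theorem abs_crossing_add_sub_le (p : ℕ → V) (n i : ℕ) (x y : V) :
    |crossing p (n + i) x y - crossing p n x y| ≤ i := by
  induction i with
  | zero => simp
  | succ i ih =>
    rw [← add_assoc, crossing_succ]
    rw [abs_le] at ih ⊢
    push_cast
    constructor <;> split_ifs <;> omega

theorem crossing_eq_zero {p : ℕ → V} {n : ℕ} {x : V} (h : ∀ k ≤ n, p k ≠ x) (y : V) :
    crossing p n x y = 0 := by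
  induction n with
  | zero => exact crossing_zero p x y
  | succ n ih =>
    rw [crossing_succ, ih fun k hk => h k (by omega)]
    simp [h n (by omega), h (n + 1) le_rfl]

theorem crossing_nonpos {p : ℕ → V} {n : ℕ} {x : V} (h : ∀ k < n, p k ≠ x) (y : V) :
    crossing p n x y ≤ 0 := by
  induction n with
  | zero => exact (crossing_zero p x y).le
  | succ n ih =>
    rw [crossing_succ]
    have := ih fun k hk => h k (by omega)
    simp only [h n (by omega), false_and, if_false]
    split_ifs <;> omega

theorem crossing_eq_zero_of_not_adj {G : SimpleGraph V} {p : ℕ → V} {n : ℕ}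
    (h : ∀ k < n, G.Adj (p k) (p (k + 1))) {x y : V} (hxy : ¬G.Adj x y) :
    crossing p n x y = 0 := by
  induction n with
  | zero => exact crossing_zero p x y
  | succ n ih =>
    have hn := h n (by omega)
    rw [crossing_succ, ih fun k hk => h k (by omega), if_neg, if_neg]
    · simp
    · rintro ⟨rfl, rfl⟩; exact hxy hn.symm
    · rintro ⟨rfl, rfl⟩; exact hxy hn

open Classical in
/-- Net crossings form a unit flow from the first to the last vertex of the path. -/
theorem sum_crossing {G : SimpleGraph V} [G.LocallyFinite] {p : ℕ → V} {n : ℕ}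
    (h : ∀ k < n, G.Adj (p k) (p (k + 1))) (x : V) :
    ∑ y ∈ G.neighborFinset x, crossing p n x y =
      (if p 0 = x then 1 else 0) - (if p n = x then 1 else 0) := by
  induction n with
  | zero => simp [crossing_zero]
  | succ n ih =>
    have hn := h n (by omega)
    simp_rw [crossing_succ]
    rw [Finset.sum_add_distrib, ih fun k hk => h k (by omega), Finset.sum_sub_distrib]
    have h1 : ∑ y ∈ G.neighborFinset x, (if p n = x ∧ p (n + 1) = y then (1 : ℤ) else 0) =
        if p n = x then 1 else 0 := by
      split_ifs with hx
      · subst hx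
        simp [hn]
      · simp [hx]
    have h2 : ∑ y ∈ G.neighborFinset x, (if p n = y ∧ p (n + 1) = x then (1 : ℤ) else 0) =
        if p (n + 1) = x then 1 else 0 := by
      split_ifs with hx
      · subst hx
        simp [hn.symm]
      · simp [hx]
    rw [h1, h2]
    ring

/-! ### Circuits -/

namespace Circuit

variable {G : SimpleGraph V} (C : Circuit G)

/-- The periodic path that spins around the circuit, beginning at its root. -/
def loop (k : ℕ) : V := C.vert ⟨k % C.len, Nat.mod_lt _ (by have := C.three_le_len; omega)⟩

theorem loop_eq_iff {j k : ℕ} : C.loop j = C.loop k ↔ j % C.len = k % C.len := by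
  unfold loop
  rw [C.injective.eq_iff, Fin.mk.injEq]

theorem loop_adj (k : ℕ) : G.Adj (C.loop k) (C.loop (k + 1)) := by
  have := C.adj ⟨k % C.len, Nat.mod_lt _ (by have := C.three_le_len; omega)⟩
  simpa [loop] using this

theorem loop_add_two_ne (k : ℕ) : C.loop (k + 2) ≠ C.loop k := by
  rw [Ne, loop_eq_iff]
  intro h
  have h3 := C.three_le_len
  have : C.len ∣ k + 2 - k := (Nat.modEq_iff_dvd' (by omega)).1 (Nat.ModEq.symm h)
  rw [Nat.add_sub_cancel_left] at this
  have := Nat.le_of_dvd (by omega) this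
  omega

theorem loop_succ_congr {j k : ℕ} (h : C.loop j = C.loop k) :
    C.loop (j + 1) = C.loop (k + 1) := by
  rw [loop_eq_iff] at h ⊢
  exact Nat.ModEq.add_right 1 h

/-- Spinning for `j` steps crosses every edge of the circuit at least `⌊j / len⌋` times, always in
the same direction. -/
theorem le_crossing_loop {q : ℕ → V} {m : ℕ} (hq : ∀ j, q (m + j) = C.loop j) (j s : ℕ) :
    crossing q m (C.loop s) (C.loop (s + 1)) + (j / C.len : ℕ) ≤
      crossing q (m + j) (C.loop s) (C.loop (s + 1)) := by
  classical
  have h3 := C.three_le_len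
  have key : crossing q (m + j) (C.loop s) (C.loop (s + 1)) =
      crossing q m (C.loop s) (C.loop (s + 1)) + (Nat.count (· ≡ s [MOD C.len]) j : ℕ) := by
    induction j with
    | zero => simp
    | succ j ih =>
      rw [← add_assoc, crossing_succ, ih, Nat.count_succ, add_assoc m j 1, hq, hq]
      have hback : ¬(C.loop j = C.loop (s + 1) ∧ C.loop (j + 1) = C.loop s) := by
        rintro ⟨ha, hb⟩
        exact C.loop_add_two_ne s ((C.loop_succ_congr ha).symm.trans hb)
      have hfwd : (C.loop j = C.loop s ∧ C.loop (j + 1) = C.loop (s + 1)) ↔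
          j ≡ s [MOD C.len] :=
        ⟨fun h => C.loop_eq_iff.1 h.1,
          fun h => ⟨C.loop_eq_iff.2 h, C.loop_succ_congr (C.loop_eq_iff.2 h)⟩⟩
      simp only [hback, hfwd, if_false]
      push_cast
      split_ifs <;> simp [add_assoc]
  rw [key, Nat.count_modEq_card _ (by omega)]
  push_cast
  split_ifs <;> omega

theorem crossing_loop_le {q : ℕ → V} {m : ℕ} (hq : ∀ j, q (m + j) = C.loop j) (j s : ℕ) {y : V}
    (hy : y ≠ C.loop (s + 1)) :
    crossing q (m + j) (C.loop s) y ≤ crossing q m (C.loop s) y := by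
  induction j with
  | zero => simp
  | succ j ih =>
    rw [← add_assoc, crossing_succ, add_assoc m j 1, hq, hq]
    have hfwd : ¬(C.loop j = C.loop s ∧ C.loop (j + 1) = y) := by
      rintro ⟨ha, hb⟩
      exact hy (hb.symm.trans (C.loop_succ_congr ha))
    simp only [hfwd, if_false]
    split_ifs <;> omega

end Circuit

theorem nonempty_circuit_of_not_isAcyclic {G : SimpleGraph V} (h : ¬G.IsAcyclic) :
    Nonempty (Circuit G) := by
  unfold SimpleGraph.IsAcyclic at h
  push Not at h
  obtain ⟨v, c, hc⟩ := h
  have h3 := hc.three_le_length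
  refine ⟨⟨c.length, h3, fun i => c.getVert i, fun i j hij => Fin.ext ?_, fun i => ?_⟩⟩
  · have := i.2
    have := j.2
    exact hc.getVert_injOn' (show i.val ≤ c.length - 1 by omega)
      (show j.val ≤ c.length - 1 by omega) hij
  · have hadj := c.adj_getVert_succ i.2
    rcases (Nat.succ_le_of_lt i.2).lt_or_eq with hi | hi
    · simpa only [Nat.mod_eq_of_lt hi] using hadj
    · rw [Nat.succ_eq_add_one] at hi
      rw [hi, SimpleGraph.Walk.getVert_length] at hadj
      simpa only [hi, Nat.mod_self, SimpleGraph.Walk.getVert_zero] using hadj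

end Crossing

/-! ### Step probabilities -/

section StepProb

variable {V : Type*} {G : SimpleGraph V} [G.LocallyFinite] {β : ℝ}

theorem stepProb_congr {p q : ℕ → V} {n : ℕ} (h : ∀ k ≤ n, p k = q k) (x : V) :
    stepProb G β p n x = stepProb G β q n x := by
  simp only [stepProb, weight, crossing_congr h]
  rw [h n le_rfl]

theorem exp_neg_le_stepProb (hβ : 0 ≤ β) {D : ℕ} (hD : ∀ x, (G.neighborFinset x).card ≤ D)
    {p : ℕ → V} {n : ℕ} {x : V} (hx : G.Adj (p n) x) {θ : ℝ}
    (h : ∀ y, G.Adj (p n) y → y ≠ x →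
      θ ≤ ((crossing p n (p n) x - crossing p n (p n) y : ℤ) : ℝ)) :
    Real.exp (-(D * Real.exp (-(β * θ)))) ≤ stepProb G β p n x := by
  classical
  unfold stepProb
  rw [if_pos hx]
  have hxm : x ∈ G.neighborFinset (p n) := by simpa using hx
  have hw : 0 < weight β p n (p n) x := Real.exp_pos _
  have hsum : ∑ y ∈ G.neighborFinset (p n), weight β p n (p n) y ≤
      weight β p n (p n) x * Real.exp (D * Real.exp (-(β * θ))) := by
    have hother : ∑ y ∈ (G.neighborFinset (p n)).erase x, weight β p n (p n) y ≤
        D * (weight β p n (p n) x * Real.exp (-(β * θ))) := by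
      calc _ ≤ ((G.neighborFinset (p n)).erase x).card •
            (weight β p n (p n) x * Real.exp (-(β * θ))) := by
            refine Finset.sum_le_card_nsmul _ _ _ fun y hy => ?_
            rw [Finset.mem_erase, SimpleGraph.mem_neighborFinset] at hy
            unfold weight
            rw [← Real.exp_add]
            refine Real.exp_le_exp.2 ?_
            have := mul_le_mul_of_nonneg_left (h y hy.2 hy.1) hβ
            push_cast at this
            linarith
        _ ≤ _ := by
            rw [nsmul_eq_mul]
            refine mul_le_mul_of_nonneg_right ?_ (by positivity)
            exact_mod_cast (Finset.card_le_card (Finset.erase_subset _ _)).trans (hD _)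
    rw [← Finset.add_sum_erase _ _ hxm]
    have := mul_le_mul_of_nonneg_left
      (Real.add_one_le_exp (D * Real.exp (-(β * θ)))) hw.le
    linarith
  have hpos : 0 < ∑ y ∈ G.neighborFinset (p n), weight β p n (p n) y :=
    Finset.sum_pos (fun y _ => Real.exp_pos _) ⟨x, hxm⟩
  rw [le_div_iff₀ hpos, Real.exp_neg]
  calc _ ≤ (Real.exp (D * Real.exp (-(β * θ))))⁻¹ *
        (weight β p n (p n) x * Real.exp (D * Real.exp (-(β * θ)))) := by gcongr
    _ = _ := by field_simp

/-- A lower bound for the probability of following forever a path whose next edge leads the other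
edges at its tail by at least `a * i - M` crossings at the `i`-th step, in a graph with degrees at
most `D`. -/
def followBound (β : ℝ) (D : ℕ) (a M : ℝ) : ℝ :=
  Real.exp (-(D * Real.exp (β * M) / (1 - Real.exp (-(β * a)))))

theorem followBound_pos (D : ℕ) (a M : ℝ) : 0 < followBound β D a M := Real.exp_pos _

theorem followBound_le_prod (hβ : 0 < β) (D : ℕ) {a : ℝ} (ha : 0 < a) (M : ℝ) (m : ℕ) :
    followBound β D a M ≤
      ∏ i ∈ Finset.range m, Real.exp (-(D * Real.exp (-(β * (a * i - M))))) := by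
  have hr : Real.exp (-(β * a)) < 1 := Real.exp_lt_one_iff.2 (by have := mul_pos hβ ha; linarith)
  rw [← Real.exp_sum, followBound, Real.exp_le_exp, Finset.sum_neg_distrib, neg_le_neg_iff]
  have hterm : ∀ i : ℕ, (D : ℝ) * Real.exp (-(β * (a * i - M))) =
      D * Real.exp (β * M) * Real.exp (-(β * a)) ^ i := fun i => by
    rw [← Real.exp_nat_mul, mul_assoc, ← Real.exp_add]
    ring_nf
  simp_rw [hterm]
  rw [← Finset.mul_sum, div_eq_mul_inv]
  refine mul_le_mul_of_nonneg_left ?_ (by positivity)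
  rw [← tsum_geometric_of_lt_one (Real.exp_pos _).le hr]
  exact (summable_geometric_of_lt_one (Real.exp_pos _).le hr).sum_le_tsum _
    fun i _ => by positivity

end StepProb

/-! ### The history of the walk and a zero-one law -/

section History

variable {Ω V : Type*} {X : ℕ → Ω → V}

/-- The event that the walk follows `q` up to time `n`. -/
def agree (X : ℕ → Ω → V) (q : ℕ → V) (n : ℕ) : Set Ω := {ω | ∀ k ≤ n, X k ω = q k}

theorem history_mono (X : ℕ → Ω → V) : Monotone (history X) := fun m n h =>
  biSup_mono fun k hk => by simp only [Finset.mem_range] at hk ⊢; omega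

theorem measurableSet_history_eq {n k : ℕ} (hk : k ≤ n) (x : V) :
    MeasurableSet[history X n] {ω | X k ω = x} := by
  have hle : MeasurableSpace.comap (X k) ⊤ ≤ history X n :=
    le_biSup (fun k => MeasurableSpace.comap (X k) ⊤) (Finset.mem_range.2 (Nat.lt_succ_of_le hk))
  exact hle _ ⟨{x}, trivial, rfl⟩

theorem measurableSet_history_agree (q : ℕ → V) (n : ℕ) :
    MeasurableSet[history X n] (agree X q n) := by
  have : agree X q n = ⋂ k ∈ Finset.range (n + 1), {ω | X k ω = q k} := by
    ext ω; simp [agree]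
  rw [this]
  exact Finset.measurableSet_biInter _ fun k hk =>
    measurableSet_history_eq (Nat.lt_succ_iff.1 (Finset.mem_range.1 hk)) _

/-- The first `n + 1` positions of the walk. -/
def initial (X : ℕ → Ω → V) (n : ℕ) (ω : Ω) : Fin (n + 1) → V := fun i => X i ω

theorem initial_eq_iff {n : ℕ} {ω ω' : Ω} :
    initial X n ω = initial X n ω' ↔ ω ∈ agree X (fun k => X k ω') n :=
  ⟨fun h k hk => congrFun h ⟨k, Nat.lt_succ_of_le hk⟩,
    fun h => funext fun i => h i (Nat.lt_succ_iff.1 i.2)⟩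

theorem history_le_comap_initial (X : ℕ → Ω → V) (n : ℕ) :
    history X n ≤ MeasurableSpace.comap (initial X n) ⊤ := by
  refine iSup₂_le fun k hk => ?_
  rintro _ ⟨s, -, rfl⟩
  exact ⟨{f | f ⟨k, Finset.mem_range.1 hk⟩ ∈ s}, trivial, rfl⟩

theorem measurableSet_history_initial [Countable V] (n : ℕ) (s : Set (Fin (n + 1) → V)) :
    MeasurableSet[history X n] (initial X n ⁻¹' s) := by
  have : initial X n ⁻¹' s = ⋃ f ∈ s, ⋂ i : Fin (n + 1), {ω | X i ω = f i} := by
    ext ω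
    simp only [Set.mem_preimage, Set.mem_iUnion, Set.mem_iInter, exists_prop]
    exact ⟨fun h => ⟨_, h, fun i => rfl⟩,
      fun ⟨f, hf, h⟩ => (funext h : initial X n ω = f) ▸ hf⟩
  rw [this]
  exact MeasurableSet.biUnion s.to_countable fun f _ =>
    MeasurableSet.iInter fun i => measurableSet_history_eq (Nat.lt_succ_iff.1 i.2) _

variable [MeasurableSpace Ω] (hX : ∀ n, Measurable[_, ⊤] (X n))
include hX

theorem history_le (n : ℕ) : history X n ≤ ‹MeasurableSpace Ω› :=
  iSup₂_le fun k _ => (hX k).comap_le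

/-- The filtration generated by the walk. -/
def historyFiltration : Filtration ℕ ‹MeasurableSpace Ω› where
  seq := history X
  mono' := history_mono X
  le' := history_le hX

variable {P : Measure Ω} [Countable V]

theorem mul_measure_le_of_agree {T : Set Ω} (hT : MeasurableSet T) {δ : ENNReal} {n : ℕ}
    {S : Set Ω} (hS : MeasurableSet[history X n] S)
    (h : ∀ ω ∈ S, δ * P (agree X (fun k => X k ω) n) ≤
      P (agree X (fun k => X k ω) n ∩ T)) :
    δ * P S ≤ P (S ∩ T) := by
  obtain ⟨s, -, rfl⟩ := history_le_comap_initial X n S hS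
  have hpart : initial X n ⁻¹' s = ⋃ f ∈ s, initial X n ⁻¹' {f} := by ext; simp
  have hmeas : ∀ f, MeasurableSet (initial X n ⁻¹' {f}) := fun f =>
    history_le hX n _ (measurableSet_history_initial n _)
  have hdisj : s.PairwiseDisjoint fun f => initial X n ⁻¹' {f} := fun f _ g _ hfg =>
    Disjoint.preimage _ (Set.disjoint_singleton.2 hfg)
  rw [hpart, Set.iUnion₂_inter, measure_biUnion s.to_countable hdisj fun f _ => hmeas f,
    measure_biUnion s.to_countable
      (hdisj.mono fun f => Set.inter_subset_left) fun f _ => (hmeas f).inter hT,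
    ← ENNReal.tsum_mul_left]
  refine ENNReal.tsum_le_tsum fun f => ?_
  rcases (initial X n ⁻¹' {f.1}).eq_empty_or_nonempty with he | ⟨ω, hω⟩
  · simp [he]
  · have hω' : initial X n ω = f.1 := hω
    have : initial X n ⁻¹' {f.1} = agree X (fun k => X k ω) n := by
      ext ω'
      rw [← initial_eq_iff, hω']; rfl
    rw [this]
    exact h ω (by simp [hω'])

/-- A conditional form of Lévy's zero-one law: if at each of the times `n` when its path belongs to
`E n` the walk has conditional probability at least `δ` to realise `T`, then almost surely `T`
occurs as soon as this happens infinitely often. -/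
theorem ae_mem_of_frequently [IsProbabilityMeasure P] {T : Set Ω} (hT : MeasurableSet[⨆ n, history X n] T)
    {E : ℕ → Set (ℕ → V)}
    (hE : ∀ n p q, (∀ k ≤ n, p k = q k) → p ∈ E n → q ∈ E n) {δ : ℝ} (hδ : 0 < δ)
    (h : ∀ n q, q ∈ E n → δ * P.real (agree X q n) ≤ P.real (agree X q n ∩ T)) :
    ∀ᵐ ω ∂P, (∃ᶠ n in Filter.atTop, (fun k => X k ω) ∈ E n) → ω ∈ T := by
  have hle := history_le hX
  have hT' : MeasurableSet T := iSup_le hle _ hT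
  set g : Ω → ℝ := T.indicator fun _ => 1 with hg
  have hgint : Integrable g P := (integrable_const 1).indicator hT'
  have hlevy : ∀ᵐ ω ∂P, Filter.Tendsto (fun n => (P[g | history X n]) ω) Filter.atTop
      (nhds (g ω)) :=
    hgint.tendsto_ae_condExp (ℱ := historyFiltration hX)
      (stronglyMeasurable_const.indicator hT)
  have hbound : ∀ n, ∀ᵐ ω ∂P, (fun k => X k ω) ∈ E n → δ ≤ (P[g | history X n]) ω := by
    intro n
    -- On the set `S` where this fails, `h` bounds the integral of the conditional probability below
    -- by `δ * P S`, so `S` is a null set.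
    set S : Set Ω := {ω | (fun k => X k ω) ∈ E n} ∩ {ω | (P[g | history X n]) ω < δ} with hSdef
    have hEm : MeasurableSet[history X n] {ω | (fun k => X k ω) ∈ E n} := by
      have : {ω | (fun k => X k ω) ∈ E n} =
          initial X n ⁻¹' (initial X n '' {ω | (fun k => X k ω) ∈ E n}) := by
        refine (Set.subset_preimage_image _ _).antisymm ?_
        rintro ω ⟨ω', hω', heq⟩
        exact hE n _ _ (initial_eq_iff.1 heq) hω'
      rw [this]
      exact measurableSet_history_initial n _
    have hSm : MeasurableSet[history X n] S :=
      hEm.inter (stronglyMeasurable_condExp.measurableSet_lt stronglyMeasurable_const)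
    have hSm' := hle n _ hSm
    have hlow : δ * P.real S ≤ P.real (S ∩ T) := by
      have := mul_measure_le_of_agree hX (P := P) (δ := ENNReal.ofReal δ) hT' hSm fun ω hω => by
        have := h n _ hω.1
        rw [measureReal_def, measureReal_def] at this
        rw [← ENNReal.ofReal_toReal (measure_ne_top P (agree X (fun k => X k ω) n)),
          ← ENNReal.ofReal_mul hδ.le]
        exact ENNReal.ofReal_le_of_le_toReal this
      have := ENNReal.toReal_mono (measure_ne_top P _) this
      rwa [ENNReal.toReal_mul, ENNReal.toReal_ofReal hδ.le] at this
    have hint : ∫ ω in S, (P[g | history X n]) ω ∂P = P.real (S ∩ T) := by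
      rw [setIntegral_condExp (hle n) hgint hSm, hg, setIntegral_indicator hT']
      simp
    have hzero : P S = 0 := by
      by_contra hne
      have hpos : 0 < ∫ ω in S, (δ - (P[g | history X n]) ω) ∂P := by
        rw [setIntegral_pos_iff_support_of_nonneg_ae]
        · refine (pos_iff_ne_zero.2 hne).trans_le (measure_mono fun ω hω => ⟨?_, hω⟩)
          have : (P[g | history X n]) ω < δ := hω.2
          exact (sub_pos.2 this).ne'
        · exact (ae_restrict_mem hSm').mono fun ω hω => by
            have : (P[g | history X n]) ω < δ := hω.2
            exact (sub_pos.2 this).le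
        · exact ((integrable_const δ).sub integrable_condExp).integrableOn
      rw [integral_sub (integrable_const δ) integrable_condExp.integrableOn, hint] at hpos
      simp only [integral_const, measureReal_restrict_apply_univ, smul_eq_mul] at hpos
      linarith
    rw [ae_iff]
    convert hzero using 2
    ext ω
    simp [hSdef]
  filter_upwards [hlevy, ae_all_iff.2 hbound] with ω hω hb hfreq
  by_contra hnot
  have hg0 : g ω = 0 := by simp [hg, hnot]
  rw [hg0] at hω
  obtain ⟨n, hn, hn'⟩ := (hfreq.and_eventually (hω.eventually (gt_mem_nhds hδ))).exists
  exact absurd (hb n hn) (not_le.2 hn')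

end History

/-! ### The probability of following a path forever -/

section Follow

variable {Ω V : Type*} [MeasurableSpace Ω] {P : Measure Ω} [IsProbabilityMeasure P]
  {G : SimpleGraph V} [G.LocallyFinite] {β : ℝ} {v : V} {X : ℕ → Ω → V}

theorem IsAntRW.measureReal_agree_succ (hX : IsAntRW G β v P X) (q : ℕ → V) (n : ℕ) :
    P.real (agree X q (n + 1)) = P.real (agree X q n) * stepProb G β q n (q (n + 1)) := by
  have hle := history_le hX.measurable
  have hm := measurableSet_history_agree (X := X) q n
  have hm1 : MeasurableSet {ω | X (n + 1) ω = q (n + 1)} :=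
    hle (n + 1) _ (measurableSet_history_eq le_rfl _)
  have hint : Integrable ({ω | X (n + 1) ω = q (n + 1)}.indicator fun _ => (1 : ℝ)) P :=
    (integrable_const 1).indicator hm1
  have h1 := setIntegral_condExp (hle n) hint hm
  rw [setIntegral_indicator hm1] at h1
  have h2 : ∫ ω in agree X q n,
      (P[{ω | X (n + 1) ω = q (n + 1)}.indicator fun _ => (1 : ℝ) | history X n]) ω ∂P =
      ∫ _ in agree X q n, stepProb G β q n (q (n + 1)) ∂P := by
    refine setIntegral_congr_ae (hle n _ hm) ?_
    filter_upwards [hX.step n (q (n + 1))] with ω hω hmem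
    rw [hω]
    exact stepProb_congr hmem _
  rw [h2] at h1
  have hset : agree X q n ∩ {ω | X (n + 1) ω = q (n + 1)} = agree X q (n + 1) := by
    ext ω
    refine ⟨fun h k hk => ?_, fun h => ⟨fun k hk => h k (by omega), h (n + 1) le_rfl⟩⟩
    rcases Nat.le_succ_iff.1 hk with hk | rfl
    exacts [h.1 k hk, h.2]
  rw [hset] at h1
  simp only [integral_const, measureReal_restrict_apply_univ, smul_eq_mul, mul_one] at h1
  exact h1.symm

theorem IsAntRW.adj_of_agree_ne_zero (hX : IsAntRW G β v P X) {q : ℕ → V} {n : ℕ}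
    (h : P.real (agree X q n) ≠ 0) : ∀ k < n, G.Adj (q k) (q (k + 1)) := by
  induction n with
  | zero => simp
  | succ n ih =>
    rw [hX.measureReal_agree_succ] at h
    intro k hk
    rcases Nat.lt_succ_iff_lt_or_eq.1 hk with hk | rfl
    · exact ih (left_ne_zero_of_mul h) k hk
    · by_contra hadj
      exact h (by simp [stepProb, hadj])

theorem IsAntRW.followBound_mul_le (hX : IsAntRW G β v P X) (hβ : 0 < β) {D : ℕ}
    (hD : ∀ x, (G.neighborFinset x).card ≤ D) {q : ℕ → V} {n : ℕ}
    (hadj : ∀ i, G.Adj (q (n + i)) (q (n + i + 1))) {a M : ℝ} (ha : 0 < a)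
    (h : ∀ i y, G.Adj (q (n + i)) y → y ≠ q (n + i + 1) →
      a * i - M ≤ ((crossing q (n + i) (q (n + i)) (q (n + i + 1)) -
        crossing q (n + i) (q (n + i)) y : ℤ) : ℝ)) :
    followBound β D a M * P.real (agree X q n) ≤ P.real {ω | ∀ k, X k ω = q k} := by
  have hfin : ∀ m, (∏ i ∈ Finset.range m, Real.exp (-(D * Real.exp (-(β * (a * i - M)))))) *
      P.real (agree X q n) ≤ P.real (agree X q (n + m)) := by
    intro m
    induction m with
    | zero => simp
    | succ m ih =>
      rw [Finset.prod_range_succ, ← add_assoc, hX.measureReal_agree_succ, mul_right_comm]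
      exact mul_le_mul ih (exp_neg_le_stepProb hβ.le hD (hadj m) (h m)) (Real.exp_pos _).le
        measureReal_nonneg
  have hset : {ω | ∀ k, X k ω = q k} = ⋂ m, agree X q (n + m) := by
    ext ω
    simp only [Set.mem_iInter]
    exact ⟨fun h m k _ => h k, fun h k => h k k (by omega)⟩
  have hlim : Filter.Tendsto (fun m => P (agree X q (n + m))) Filter.atTop
      (nhds (P {ω | ∀ k, X k ω = q k})) := by
    rw [hset]
    refine tendsto_measure_iInter_atTop (fun m => ?_) (fun m m' hm ω hω k hk => hω k (by omega))
      ⟨0, measure_ne_top _ _⟩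
    exact (history_le hX.measurable _ _ (measurableSet_history_agree q _)).nullMeasurableSet
  refine ge_of_tendsto' ((ENNReal.tendsto_toReal (measure_ne_top _ _)).comp hlim) fun m => ?_
  exact (mul_le_mul_of_nonneg_right (followBound_le_prod hβ D ha M m)
    measureReal_nonneg).trans (hfin m)

end Follow

/-! ### Being trapped in a circuit -/

section Trapped

variable {Ω V : Type*} {G : SimpleGraph V} {X : ℕ → Ω → V}

instance [Countable V] : Countable (Circuit G) := by
  refine Function.Injective.countable
    (f := fun C : Circuit G => (⟨C.len, C.vert⟩ : Σ n, Fin n → V)) ?_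
  rintro ⟨l, _, u, _, _⟩ ⟨l', _, u', _, _⟩ h
  simp only [Sigma.mk.injEq] at h
  obtain ⟨rfl, h⟩ := h
  obtain rfl := eq_of_heq h
  rfl

theorem measurableSet_iUnion_trapped [Countable V] :
    MeasurableSet[⨆ n, history X n] (⋃ C : Circuit G, trapped X C) := by
  refine MeasurableSet.iUnion fun C => MeasurableSet.iUnion fun m => ?_
  have : trappedAt X C m = ⋂ i, {ω | X (m + i) ω = C.loop i} := by
    ext ω; simp [trappedAt, Circuit.loop]
  rw [this]
  exact MeasurableSet.iInter fun i =>
    le_iSup (history X) (m + i) _ (measurableSet_history_eq le_rfl _)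

variable [MeasurableSpace Ω] {P : Measure Ω} [IsProbabilityMeasure P] [G.LocallyFinite]
  {β : ℝ} {v : V}

/-- If, after the path `p` up to time `n`, some continuation `w` reaches a circuit of length at most
`L` within `K` steps and then spins around it, always using edges that are within `M` crossings of
the most favourable one, then the walk is trapped with conditional probability bounded below in
terms of `L`, `K` and `M` only: each turn increases by one the lead of the edges of the circuit. -/
theorem IsAntRW.followBound_mul_le_trapped (hX : IsAntRW G β v P X) (hβ : 0 < β) {D : ℕ}
    (hD : ∀ x, (G.neighborFinset x).card ≤ D) {p w : ℕ → V} {n : ℕ} (hw0 : w 0 = p n)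
    (hadj : ∀ i, G.Adj (w i) (w (i + 1))) {k₀ K L M : ℕ} (hk₀ : k₀ ≤ K) {C : Circuit G}
    (hL : C.len ≤ L) (hloop : ∀ j, w (k₀ + j) = C.loop j)
    (hM : ∀ i y, G.Adj (w i) y →
      crossing p n (w i) y - M ≤ crossing p n (w i) (w (i + 1))) :
    followBound β D (1 / L) (M + 3 * K + 1) * P.real (agree X p n) ≤
      P.real (agree X p n ∩ ⋃ C : Circuit G, trapped X C) := by
  set q : ℕ → V := fun k => if k ≤ n then p k else w (k - n) with hq
  have hqp : ∀ k ≤ n, q k = p k := fun k hk => if_pos hk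
  have hqw : ∀ i, q (n + i) = w i := by
    intro i
    rcases Nat.eq_zero_or_pos i with rfl | hi
    · rw [hw0]; exact hqp n le_rfl
    · simp [hq, show ¬(n + i ≤ n) by omega]
  have hql : ∀ j, q (n + k₀ + j) = C.loop j := fun j => by rw [add_assoc, hqw, hloop]
  have hagree : agree X q n = agree X p n := by
    ext ω
    exact ⟨fun h k hk => (h k hk).trans (hqp k hk), fun h k hk => (h k hk).trans (hqp k hk).symm⟩
  have h3 := C.three_le_len
  have hLpos : (0 : ℝ) < L := by exact_mod_cast (by omega : 0 < L)
  have hL1 : (1 : ℝ) ≤ L := by exact_mod_cast (by omega : 1 ≤ L)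
  have hmain := hX.followBound_mul_le hβ hD (q := q) (n := n) (a := 1 / L) (M := M + 3 * K + 1)
    (fun i => by rw [hqw, add_assoc, hqw]; exact hadj i) (by positivity) (fun i y hy hne => by
      rw [hqw] at hy
      rw [add_assoc, hqw] at hne
      rw [add_assoc n i 1, hqw, hqw]
      have hM' := hM i y hy
      rw [← crossing_congr hqp, ← crossing_congr hqp] at hM'
      -- Up to time `k₀` a lead has changed by at most `2 * K`; after `j` more steps, it has gained at
      -- least `j / C.len`.
      rcases le_total i k₀ with hi | hi
      · have e1 := abs_le.1 (abs_crossing_add_sub_le q n i (w i) y)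
        have e2 := abs_le.1 (abs_crossing_add_sub_le q n i (w i) (w (i + 1)))
        have hlow : -(M : ℤ) - 2 * K ≤ crossing q (n + i) (w i) (w (i + 1)) -
            crossing q (n + i) (w i) y := by omega
        have hlow' : -(M : ℝ) - 2 * K ≤ ((crossing q (n + i) (w i) (w (i + 1)) -
            crossing q (n + i) (w i) y : ℤ) : ℝ) := by exact_mod_cast hlow
        have hiK : (i : ℝ) ≤ K := by exact_mod_cast hi.trans hk₀
        have : 1 / (L : ℝ) * i ≤ i :=
          mul_le_of_le_one_left (by positivity) ((div_le_one hLpos).2 hL1)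
        linarith
      · obtain ⟨j, rfl⟩ := Nat.exists_eq_add_of_le hi
        rw [add_assoc k₀ j 1, hloop, hloop] at *
        have e1 := abs_le.1 (abs_crossing_add_sub_le q n k₀ (C.loop j) y)
        have e2 := abs_le.1 (abs_crossing_add_sub_le q n k₀ (C.loop j) (C.loop (j + 1)))
        have e3 := C.le_crossing_loop hql j j
        have e4 := C.crossing_loop_le hql j j hne
        rw [← add_assoc n k₀ j]
        have hlow : ((j / C.len : ℕ) : ℤ) - M - 2 * K ≤
            crossing q (n + k₀ + j) (C.loop j) (C.loop (j + 1)) -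
            crossing q (n + k₀ + j) (C.loop j) y := by omega
        have hlow' : ((j / C.len : ℕ) : ℝ) - M - 2 * K ≤
            ((crossing q (n + k₀ + j) (C.loop j) (C.loop (j + 1)) -
            crossing q (n + k₀ + j) (C.loop j) y : ℤ) : ℝ) := by exact_mod_cast hlow
        have hdiv : (j / L : ℝ) ≤ ((j / C.len : ℕ) : ℝ) + 1 := by
          rw [div_le_iff₀ hLpos]
          have h1 : j ≤ (j / C.len + 1) * C.len := by
            have := Nat.lt_div_mul_add (a := j) (b := C.len) (by omega)
            rw [add_mul, one_mul]; exact this.le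
          have h2 : j ≤ (j / C.len + 1) * L := h1.trans (Nat.mul_le_mul_left _ hL)
          exact_mod_cast h2
        have hkK : 1 / (L : ℝ) * k₀ ≤ K :=
          (mul_le_of_le_one_left (by positivity) ((div_le_one hLpos).2 hL1)).trans
            (by exact_mod_cast hk₀)
        have hsplit : 1 / (L : ℝ) * ((k₀ + j : ℕ) : ℝ) = 1 / (L : ℝ) * k₀ + j / L := by
          push_cast; ring
        rw [hsplit]
        linarith)
  rw [hagree] at hmain
  refine hmain.trans (measureReal_mono ?_)
  intro ω hω
  have hω : ∀ k, X k ω = q k := hω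
  refine ⟨fun k hk => (hω k).trans (hqp k hk), Set.mem_iUnion.2 ⟨C, Set.mem_iUnion.2
    ⟨n + k₀, fun i => ?_⟩⟩⟩
  rw [hω, hql]; rfl

end Trapped

/-! ### Flows and circuits -/

section Flow

/-- Among `card s + 1` consecutive scales, one interval avoids all the values of `φ` on `s`. -/
theorem exists_scale_gap {α : Type*} (s : Finset α) (φ : α → ℕ) {L : ℕ → ℕ} (hL : Monotone L) :
    ∃ i ≤ s.card, ∀ a ∈ s, φ a ≤ L i ∨ L (i + 1) < φ a := by
  by_contra! h
  have : Nonempty α := ⟨(h 0 (Nat.zero_le _)).choose⟩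
  choose! g hg using h
  obtain ⟨i, hi, j, hj, hne, heq⟩ := Finset.exists_ne_map_eq_of_card_lt_of_maps_to
    (s := Finset.range (s.card + 1)) (t := s) (f := g) (by simp)
    (fun i hi => (hg i (Nat.lt_succ_iff.1 (Finset.mem_range.1 hi))).1)
  have hi' := hg i (Nat.lt_succ_iff.1 (Finset.mem_range.1 hi))
  have hj' := hg j (Nat.lt_succ_iff.1 (Finset.mem_range.1 hj))
  rw [← heq] at hj'
  rcases lt_or_gt_of_ne hne with hlt | hlt
  · have := hL (Nat.succ_le_of_lt hlt)
    simp only [Nat.succ_eq_add_one] at this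
    omega
  · have := hL (Nat.succ_le_of_lt hlt)
    simp only [Nat.succ_eq_add_one] at this
    omega

/-- Scales growing so fast that at a vertex of degree at most `D` a flow value above one scale
cannot be balanced by values below the previous scale. -/
def scale (D : ℕ) : ℕ → ℕ
  | 0 => 1
  | i + 1 => (D + 1) * scale D i + 1

theorem scale_mono (D : ℕ) : Monotone (scale D) :=
  monotone_nat_of_le_succ fun i => by
    have : scale D i ≤ (D + 1) * scale D i := Nat.le_mul_of_pos_left _ (by omega)
    simp only [scale]; omega

variable {V : Type*} {G : SimpleGraph V}

/-- A finite orbit of a map which moves along edges and never backtracks immediately runs into a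
circuit. -/
theorem exists_circuit_of_iterate {F : V → V} {B : Finset V} {z : V}
    (hB : ∀ i, F^[i] z ∈ B) (hadj : ∀ i, G.Adj (F^[i] z) (F^[i + 1] z))
    (hback : ∀ i, F^[i + 2] z ≠ F^[i] z) :
    ∃ i ≤ B.card, ∃ C : Circuit G, C.len ≤ B.card ∧ ∀ j, F^[i + j] z = C.loop j := by
  obtain ⟨i, j, hij, hj, heq⟩ : ∃ i j, i < j ∧ j ≤ B.card ∧ F^[i] z = F^[j] z := by
    obtain ⟨i, hi, j, hj, hne, heq⟩ := Finset.exists_ne_map_eq_of_card_lt_of_maps_to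
      (s := Finset.range (B.card + 1)) (t := B) (f := fun i => F^[i] z) (by simp)
      (fun i _ => hB i)
    simp only [Finset.mem_range] at hi hj
    rcases lt_or_gt_of_ne hne with h | h
    · exact ⟨i, j, h, by omega, heq⟩
    · exact ⟨j, i, h, by omega, heq.symm⟩
  set y := F^[i] z with hy
  have hiter : ∀ k, F^[k] y = F^[i + k] z := fun k => by
    rw [hy, ← Function.iterate_add_apply, add_comm]
  have hper : Function.IsPeriodicPt F (j - i) y := by
    change F^[j - i] y = y
    rw [hiter, show i + (j - i) = j by omega, ← heq]
  set l := Function.minimalPeriod F y with hl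
  have hl0 : 0 < l := hper.minimalPeriod_pos (by omega)
  have hle : l ≤ j - i := hper.minimalPeriod_le (by omega)
  have hfix : F^[l] y = y := Function.iterate_minimalPeriod
  have hl3 : 3 ≤ l := by
    by_contra hlt
    have : l = 1 ∨ l = 2 := by omega
    rcases this with h | h
    · rw [h, hiter] at hfix
      exact (hadj i).ne hfix.symm
    · rw [h, hiter] at hfix
      exact hback i hfix
  refine ⟨i, by omega, ⟨l, hl3, fun s => F^[s] y, fun s t hst => ?_, fun s => ?_⟩,
    by change l ≤ _; omega, fun k => ?_⟩
  · exact Fin.ext (Function.iterate_injOn_Iio_minimalPeriod s.2 t.2 hst)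
  · have : F^[(s.val + 1) % l] y = F^[s.val + 1] y := Function.iterate_mod_minimalPeriod_eq
    simp only [this]
    rw [hiter, hiter]
    exact hadj _
  · have : F^[k % l] y = F^[k] y := Function.iterate_mod_minimalPeriod_eq
    rw [← hiter, ← this]; rfl

/-- The concatenation of a finite walk with an infinite path. -/
theorem exists_append_path {x z : V} (r : G.Walk x z) {w' : ℕ → V} (hw0 : w' 0 = z)
    (hadj : ∀ i, G.Adj (w' i) (w' (i + 1))) :
    ∃ w : ℕ → V, w 0 = x ∧ (∀ i, G.Adj (w i) (w (i + 1))) ∧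
      (∀ i < r.length, w i = r.getVert i) ∧ ∀ i, w (r.length + i) = w' i := by
  set w : ℕ → V := fun i => if i < r.length then r.getVert i else w' (i - r.length) with hw
  have hlt : ∀ i < r.length, w i = r.getVert i := fun i hi => if_pos hi
  have hle : ∀ i ≤ r.length, w i = r.getVert i := by
    intro i hi
    rcases hi.lt_or_eq with hi | rfl
    · exact hlt i hi
    · simp [hw, hw0]
  have hge : ∀ i, w (r.length + i) = w' i := fun i => by simp [hw]
  refine ⟨w, by rw [hle 0 (Nat.zero_le _), SimpleGraph.Walk.getVert_zero], fun i => ?_, hlt, hge⟩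
  rcases lt_or_ge i r.length with hi | hi
  · rw [hle i hi.le, hle (i + 1) hi]
    exact r.adj_getVert_succ hi
  · obtain ⟨j, rfl⟩ := Nat.exists_eq_add_of_le hi
    rw [add_assoc, hge, hge]
    exact hadj j

variable [G.LocallyFinite] {c : V → V → ℤ} {D L L' : ℕ}

/-- In a flow with bounded sources and no value between two well separated scales, a vertex on an
edge with a large value has an outgoing edge with a large value. -/
theorem exists_large_out_edge (hD : ∀ x, (G.neighborFinset x).card ≤ D)
    (hsupp : ∀ x y, c x y ≠ 0 → G.Adj x y) (hsum : ∀ x, -1 ≤ ∑ y ∈ G.neighborFinset x, c x y)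
    (hLL' : D * L < L') (hgap : ∀ x y, |c x y| ≤ L ∨ L' < |c x y|) {x y : V}
    (hxy : L < |c x y|) :
    ∃ z, G.Adj x z ∧ L < c x z ∧ ∀ z', G.Adj x z' → c x z' ≤ c x z := by
  classical
  have hy : y ∈ G.neighborFinset x := by
    rw [SimpleGraph.mem_neighborFinset]
    refine hsupp x y fun h => ?_
    rw [h, abs_zero] at hxy
    omega
  obtain ⟨z, hz, hmax⟩ := Finset.exists_max_image (G.neighborFinset x) (c x) ⟨y, hy⟩
  refine ⟨z, by simpa using hz, ?_, fun z' hz' => hmax z' (by simpa using hz')⟩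
  by_contra hzL
  rw [not_lt] at hzL
  have hneg : c x y < -L' := by
    have h1 : (L' : ℤ) < |c x y| := (hgap x y).resolve_left (not_le.2 hxy)
    have h2 := hmax y hy
    rcases abs_cases (c x y) with ⟨h, _⟩ | ⟨h, _⟩ <;> omega
  have hrest : ∑ t ∈ (G.neighborFinset x).erase y, c x t ≤ D * L := by
    calc _ ≤ ((G.neighborFinset x).erase y).card • (L : ℤ) :=
          Finset.sum_le_card_nsmul _ _ _ fun t ht =>
            (hmax t (Finset.mem_of_mem_erase ht)).trans hzL
      _ ≤ _ := by
          rw [nsmul_eq_mul]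
          refine mul_le_mul_of_nonneg_right ?_ (by positivity)
          exact_mod_cast (Finset.card_le_card (Finset.erase_subset _ _)).trans (hD _)
  have hs := hsum x
  rw [← Finset.add_sum_erase _ _ hy] at hs
  have : ((D * L : ℕ) : ℤ) < L' := by exact_mod_cast hLL'
  push_cast at this
  omega

/-- In a flow with bounded sources and no value between two well separated scales, every vertex of
`B` is the starting point of a path which reaches a circuit in a bounded number of steps and spins
around it, using only edges that are almost the most favourable ones at their tails. If some edge
carries a large value, the path goes to the nearest vertex on such an edge, where it begins to follow
the largest outgoing values; otherwise it goes to the given circuit `C₀`. -/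
theorem exists_spinning_path (hD : ∀ x, (G.neighborFinset x).card ≤ D) (hconn : G.Connected)
    (C₀ : Circuit G) {B : Finset V} {K : ℕ}
    (hK : ∀ x ∈ B, ∀ y, y ∈ B ∨ y = C₀.loop 0 → G.dist x y ≤ K)
    (hanti : ∀ x y, c y x = -c x y) (hsupp : ∀ x y, c x y ≠ 0 → G.Adj x y)
    (hB : ∀ x y, c x y ≠ 0 → x ∈ B) (hsum : ∀ x, -1 ≤ ∑ y ∈ G.neighborFinset x, c x y)
    (hLL' : D * L < L') (hgap : ∀ x y, |c x y| ≤ L ∨ L' < |c x y|) {x₀ : V} (hx₀ : x₀ ∈ B) :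
    ∃ w : ℕ → V, w 0 = x₀ ∧ (∀ i, G.Adj (w i) (w (i + 1))) ∧
      (∀ i y, G.Adj (w i) y → c (w i) y - (2 * L : ℕ) ≤ c (w i) (w (i + 1))) ∧
      ∃ k₀ ≤ K + B.card, ∃ C : Circuit G, C.len ≤ B.card + C₀.len ∧
        ∀ j, w (k₀ + j) = C.loop j := by
  have hflat : ∀ {x}, (¬∃ y, (L : ℤ) < |c x y|) → ∀ y y', c x y - (2 * L : ℕ) ≤ c x y' := by
    intro x hx y y'
    push Not at hx
    have h1 := abs_le.1 (hx y)
    have h2 := abs_le.1 (hx y')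
    push_cast
    omega
  by_cases hbig : ∃ z y, (L : ℤ) < |c z y|
  · -- `F` follows the largest outgoing value; it preserves the set of vertices on large edges.
    have hout : ∀ x, (∃ y, (L : ℤ) < |c x y|) →
        ∃ z, G.Adj x z ∧ L < c x z ∧ ∀ z', G.Adj x z' → c x z' ≤ c x z :=
      fun x ⟨_, hy⟩ => exists_large_out_edge hD hsupp hsum hLL' hgap hy
    have : Nonempty V := ⟨x₀⟩
    choose! F hFadj hFlarge hFmax using hout
    have hFbig : ∀ x, (∃ y, (L : ℤ) < |c x y|) → ∃ y, (L : ℤ) < |c (F x) y| := fun x hx =>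
      ⟨x, by rw [hanti, abs_neg]; exact (hFlarge x hx).trans_le (le_abs_self _)⟩
    have hbigB : ∀ x, (∃ y, (L : ℤ) < |c x y|) → x ∈ B := fun x ⟨y, hy⟩ => hB x y fun h => by
      rw [h, abs_zero] at hy; omega
    obtain ⟨z, hz, hmin⟩ : ∃ z, (∃ y, (L : ℤ) < |c z y|) ∧
        ∀ z', (∃ y, (L : ℤ) < |c z' y|) → G.dist x₀ z ≤ G.dist x₀ z' := by
      obtain ⟨z, hz, hmin⟩ := (InvImage.wf (G.dist x₀) Nat.lt_wfRel.wf).has_min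
        {z | ∃ y, (L : ℤ) < |c z y|} hbig
      exact ⟨z, hz, fun z' hz' => not_lt.1 (hmin z' hz')⟩
    have hiter : ∀ i, ∃ y, (L : ℤ) < |c (F^[i] z) y| := by
      intro i
      induction i with
      | zero => exact hz
      | succ i ih => rw [Function.iterate_succ_apply']; exact hFbig _ ih
    have hadj : ∀ i, G.Adj (F^[i] z) (F^[i + 1] z) := fun i => by
      rw [Function.iterate_succ_apply']; exact hFadj _ (hiter i)
    have hback : ∀ i, F^[i + 2] z ≠ F^[i] z := fun i h => by
      have h1 := hFlarge _ (hiter i)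
      have h2 := hFlarge _ (hiter (i + 1))
      rw [← Function.iterate_succ_apply' F (i + 1), h, Function.iterate_succ_apply', hanti] at h2
      omega
    obtain ⟨i₀, hi₀, C, hC, hloop⟩ :=
      exists_circuit_of_iterate (fun i => hbigB _ (hiter i)) hadj hback
    obtain ⟨r, hr⟩ := hconn.exists_walk_length_eq_dist x₀ z
    obtain ⟨w, hw0, hwadj, hwlt, hwge⟩ :=
      exists_append_path r (w' := fun i => F^[i] z) rfl hadj
    refine ⟨w, hw0, hwadj, fun i y hy => ?_, r.length + i₀, ?_, C, by omega, fun j => ?_⟩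
    · rcases lt_or_ge i r.length with hi | hi
      · refine hflat (fun hx => ?_) _ _
        have h1 := hmin _ hx
        rw [hwlt i hi] at h1
        have h2 : G.dist x₀ (r.getVert i) ≤ i := by
          refine (SimpleGraph.dist_le (r.take i)).trans ?_
          rw [SimpleGraph.Walk.take_length]
          exact min_le_left _ _
        omega
      · obtain ⟨j, rfl⟩ := Nat.exists_eq_add_of_le hi
        rw [hwge] at hy ⊢
        rw [add_assoc, hwge]
        have := hFmax _ (hiter j) y hy
        rw [← Function.iterate_succ_apply' F j, Nat.succ_eq_add_one] at this
        push_cast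
        omega
    · have := hK x₀ hx₀ z (Or.inl (hbigB z hz))
      omega
    · rw [add_assoc, hwge, hloop]
  · push Not at hbig
    obtain ⟨r, hr⟩ := hconn.exists_walk_length_eq_dist x₀ (C₀.loop 0)
    obtain ⟨w, hw0, hwadj, -, hwge⟩ := exists_append_path r (w' := C₀.loop) rfl C₀.loop_adj
    refine ⟨w, hw0, hwadj, fun i y _ => hflat (by push Not; exact hbig _) _ _, r.length, ?_, C₀,
      by omega, hwge⟩
    have := hK x₀ hx₀ _ (Or.inr rfl)
    omega

end Flow

/-! ### Walks with finite range -/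

section FiniteRange

variable {Ω V : Type*} [MeasurableSpace Ω] {P : Measure Ω} [IsProbabilityMeasure P] [Countable V]
  {G : SimpleGraph V} [G.LocallyFinite] {β : ℝ} {v : V} {X : ℕ → Ω → V}

theorem IsAntRW.ae_trapped_of_forall_mem (hX : IsAntRW G β v P X) (hβ : 0 < β) {D : ℕ}
    (hD : ∀ x, (G.neighborFinset x).card ≤ D) (hconn : G.Connected) (C₀ : Circuit G)
    (B : Finset V) :
    ∀ᵐ ω ∂P, (∀ k, X k ω ∈ B) → ω ∈ ⋃ C : Circuit G, trapped X C := by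
  classical
  set K := (B ×ˢ insert (C₀.loop 0) B).sup fun e => G.dist e.1 e.2 with hKdef
  have hK : ∀ x ∈ B, ∀ y, y ∈ B ∨ y = C₀.loop 0 → G.dist x y ≤ K := fun x hx y hy =>
    Finset.le_sup (f := fun e : V × V => G.dist e.1 e.2) (b := (x, y))
      (by simp only [Finset.mem_product, Finset.mem_insert]; exact ⟨hx, hy.symm⟩)
  set M := 2 * scale D (B ×ˢ B).card with hMdef
  have hmain := ae_mem_of_frequently (P := P) hX.measurable
    (measurableSet_iUnion_trapped (G := G) (X := X))
    (E := fun n => {p | ∀ k ≤ n, p k ∈ B}) (fun n p q hpq hp k hk => hpq k hk ▸ hp k hk)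
    (followBound_pos (β := β) D (1 / (B.card + C₀.len : ℕ)) (M + 3 * (K + B.card : ℕ) + 1))
    (fun n q hq => by
      by_cases h0 : P.real (agree X q n) = 0
      · rw [h0, mul_zero]; exact measureReal_nonneg
      have hadj := hX.adj_of_agree_ne_zero h0
      have hmem : ∀ x y, crossing q n x y ≠ 0 → x ∈ B := fun x y hxy => by
        by_contra hx
        exact hxy (crossing_eq_zero (fun k hk hkx => hx (by rw [← hkx]; exact hq k hk)) y)
      have hmem' : ∀ x y, crossing q n x y ≠ 0 → y ∈ B := fun x y hxy =>
        hmem y x (by rw [crossing_antisymm]; exact neg_ne_zero.2 hxy)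
      obtain ⟨i, hi, hgap⟩ := exists_scale_gap (B ×ˢ B)
        (fun e => (crossing q n e.1 e.2).natAbs) (scale_mono D)
      obtain ⟨w, hw0, hwadj, hwM, k₀, hk₀, C, hC, hloop⟩ :=
        exists_spinning_path (c := crossing q n) (L := scale D i) (L' := scale D (i + 1)) hD hconn
          C₀ hK (fun x y => crossing_antisymm q n x y)
          (fun x y hxy => not_not.1 fun h => hxy (crossing_eq_zero_of_not_adj hadj h))
          hmem (fun x => by rw [sum_crossing hadj]; split_ifs <;> simp)
          (by simp only [scale]; nlinarith)
          (fun x y => by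
            by_cases h : crossing q n x y = 0
            · left; rw [h, abs_zero]; positivity
            · have := hgap (x, y) (Finset.mem_product.2 ⟨hmem x y h, hmem' x y h⟩)
              simp only at this
              rw [Int.abs_eq_natAbs]
              exact_mod_cast this)
          (hq n le_rfl)
      refine hX.followBound_mul_le_trapped hβ hD hw0 hwadj hk₀ hC hloop fun j y hy => ?_
      have := hwM j y hy
      have hs := scale_mono D hi
      omega)
  filter_upwards [hmain] with ω hω hB
  exact hω (Filter.Frequently.of_forall fun n k _ => hB k)

theorem IsAntRW.ae_trapped_of_finite_range (hX : IsAntRW G β v P X) (hβ : 0 < β) {D : ℕ}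
    (hD : ∀ x, (G.neighborFinset x).card ≤ D) (hconn : G.Connected) (C₀ : Circuit G) :
    ∀ᵐ ω ∂P, (Set.range fun k => X k ω).Finite → ω ∈ ⋃ C : Circuit G, trapped X C := by
  filter_upwards [ae_all_iff.2 (hX.ae_trapped_of_forall_mem hβ hD hconn C₀)] with ω hω hfin
  exact hω hfin.toFinset fun k => by simp

end FiniteRange

/-! ### The lattice -/

section Lattice

variable {d : ℕ}

theorem lattice_adj {x y : Fin d → ℤ} : (lattice d).Adj x y ↔ ∑ i, |x i - y i| = 1 := Iff.rfl

theorem card_neighborFinset_lattice_le (x : Fin d → ℤ) :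
    ((lattice d).neighborFinset x).card ≤
      (Finset.Icc (fun _ => -1 : Fin d → ℤ) fun _ => 1).card := by
  refine Finset.card_le_card_of_injOn (fun y => x - y) (fun y hy => ?_)
    fun y _ z _ h => sub_right_injective h
  have hs : ∑ i, |x i - y i| = 1 := (SimpleGraph.mem_neighborFinset _ _ _).1 hy
  have h : ∀ i, |x i - y i| ≤ 1 := fun i =>
    hs ▸ Finset.single_le_sum (f := fun i => |x i - y i|) (fun j _ => abs_nonneg _)
      (Finset.mem_univ i)
  simp only [Finset.coe_Icc, Set.mem_Icc]
  exact ⟨fun i => (abs_le.1 (h i)).1, fun i => (abs_le.1 (h i)).2⟩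

theorem lattice_adj_add_single (x : Fin d → ℤ) (i : Fin d) {s : ℤ} (hs : |s| = 1) :
    (lattice d).Adj x (x + Pi.single i s) := by
  rw [lattice_adj, Finset.sum_eq_single i]
  · simp [hs]
  · intro k _ hk
    simp [hk]
  · simp

theorem lattice_connected (d : ℕ) : (lattice d).Connected := by
  have key : ∀ (n : ℕ) (x y : Fin d → ℤ), ∑ i, (x i - y i).natAbs = n →
      (lattice d).Reachable x y := by
    intro n
    induction n using Nat.strong_induction_on with
    | _ n ih =>
      intro x y hn
      by_cases hxy : x = y
      · exact hxy ▸ SimpleGraph.Reachable.refl _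
      obtain ⟨i, hi⟩ := Function.ne_iff.1 hxy
      obtain ⟨s, hs, hlt⟩ : ∃ s : ℤ, |s| = 1 ∧
          (x i + s - y i).natAbs < (x i - y i).natAbs := by
        rcases lt_or_gt_of_ne hi with h | h
        · exact ⟨1, by simp, by omega⟩
        · exact ⟨-1, by simp, by omega⟩
      refine (lattice_adj_add_single x i hs).reachable.trans (ih _ ?_ _ y rfl)
      rw [← hn]
      refine Finset.sum_lt_sum (fun k _ => ?_) ⟨i, Finset.mem_univ i, by simpa using hlt⟩
      by_cases hk : k = i
      · subst hk; simpa using hlt.le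
      · simp [hk]
  have : Nonempty (Fin d → ℤ) := ⟨0⟩
  exact ⟨fun x y => key _ x y rfl⟩

/-- The corners of the unit square with root `x`, first side in direction `j` and second side in
direction `s` times the `i`-th unit vector. -/
def corner (x : Fin d → ℤ) (i j : Fin d) (s : ℤ) : Fin 4 → Fin d → ℤ :=
  ![x, x + Pi.single j 1, x + Pi.single i s + Pi.single j 1, x + Pi.single i s]

theorem corner_injective (x : Fin d → ℤ) {i j : Fin d} (hij : i ≠ j) {s : ℤ} (hs : |s| = 1) :
    Function.Injective (corner x i j s) := by
  have hs0 : s ≠ 0 := by rintro rfl; simp at hs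
  have hi : ∀ a, corner x i j s a i = x i + ![0, 0, s, s] a := fun a => by
    fin_cases a <;> simp [corner, hij]
  have hj : ∀ a, corner x i j s a j = x j + ![0, 1, 1, 0] a := fun a => by
    fin_cases a <;> simp [corner, hij.symm]
  intro a b hab
  have h1 : (![0, 0, s, s] : Fin 4 → ℤ) a = ![0, 0, s, s] b :=
    add_left_cancel ((hi a).symm.trans ((congrFun hab i).trans (hi b)))
  have h2 : (![0, 1, 1, 0] : Fin 4 → ℤ) a = ![0, 1, 1, 0] b :=
    add_left_cancel ((hj a).symm.trans ((congrFun hab j).trans (hj b)))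
  clear hi hj hab
  fin_cases a <;> fin_cases b <;> simp at h1 h2 ⊢ <;> omega

theorem corner_adj (x : Fin d → ℤ) (i j : Fin d) {s : ℤ} (hs : |s| = 1) (a : Fin 4) :
    (lattice d).Adj (corner x i j s a) (corner x i j s (a + 1)) := by
  have hj := fun y : Fin d → ℤ => lattice_adj_add_single y j (s := 1) abs_one
  have hi := fun y : Fin d → ℤ => lattice_adj_add_single y i hs
  have h0 : corner x i j s 0 = x := rfl
  have h1 : corner x i j s 1 = x + Pi.single j 1 := rfl
  have h2 : corner x i j s 2 = x + Pi.single i s + Pi.single j 1 := rfl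
  have h3 : corner x i j s 3 = x + Pi.single i s := rfl
  match a with
  | 0 => rw [zero_add, h0, h1]; exact hj x
  | 1 => rw [show (1 : Fin 4) + 1 = 2 from rfl, h1, h2, add_right_comm]; exact hi _
  | 2 => rw [show (2 : Fin 4) + 1 = 3 from rfl, h2, h3]; exact (hj _).symm
  | 3 => rw [show (3 : Fin 4) + 1 = 0 from rfl, h3, h0]; exact (hi x).symm

/-- The unit square as a circuit of the lattice. -/
def square (x : Fin d → ℤ) {i j : Fin d} (hij : i ≠ j) {s : ℤ} (hs : |s| = 1) :
    Circuit (lattice d) where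
  len := 4
  three_le_len := by omega
  vert := corner x i j s
  injective := corner_injective x hij hs
  adj a := by
    have : (⟨(a.val + 1) % 4, Nat.mod_lt _ (by omega)⟩ : Fin 4) = a + 1 :=
      Fin.ext (by simp [Fin.val_add])
    rw [this]
    exact corner_adj x i j hs a

theorem square_loop_zero (x : Fin d → ℤ) {i j : Fin d} (hij : i ≠ j) {s : ℤ} (hs : |s| = 1) :
    (square x hij hs).loop 0 = x := rfl

theorem le_mul_square_loop (x : Fin d → ℤ) {i j : Fin d} (hij : i ≠ j) {s : ℤ} (hs : |s| = 1)
    (k : ℕ) : s * x i ≤ s * (square x hij hs).loop k i := by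
  have hss : s * s = 1 := by rw [← abs_mul_abs_self, hs, one_mul]
  have : ∀ a : Fin 4, s * x i ≤ s * corner x i j s a i := by
    intro a
    fin_cases a <;> simp [corner, hij, mul_add, hss]
  exact this ⟨k % 4, Nat.mod_lt _ (by omega)⟩

/-- The paths which at time `n` strictly exceed their past in one of the `2 d` coordinate
directions. -/
def recordAt (d n : ℕ) : Set (ℕ → Fin d → ℤ) :=
  {p | ∃ i, ∃ s : ℤ, |s| = 1 ∧ ∀ k < n, s * p k i < s * p n i}

theorem finite_range_of_eventually_not_record {p : ℕ → Fin d → ℤ}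
    (h : ¬∃ᶠ n in Filter.atTop, p ∈ recordAt d n) : (Set.range p).Finite := by
  rw [Filter.not_frequently, Filter.eventually_atTop] at h
  obtain ⟨N, hN⟩ := h
  have hpast : ∀ (i : Fin d) (s : ℤ), |s| = 1 → ∀ n, ∃ k ≤ N, s * p n i ≤ s * p k i := by
    intro i s hs n
    induction n using Nat.strong_induction_on with
    | _ n ih =>
      by_cases hn : n ≤ N
      · exact ⟨n, hn, le_rfl⟩
      have hrec := hN n (by omega)
      simp only [recordAt, Set.mem_ofPred_eq, not_exists, not_and, not_forall, not_lt] at hrec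
      obtain ⟨k, hk, hle⟩ := hrec i s hs
      obtain ⟨k', hk', hle'⟩ := ih k hk
      exact ⟨k', hk', hle.trans hle'⟩
  set R : Fin d → ℤ := fun i => ∑ k ∈ Finset.range (N + 1), |p k i| with hR
  have hle : ∀ k ≤ N, ∀ i, |p k i| ≤ R i := fun k hk i =>
    Finset.single_le_sum (f := fun k => |p k i|) (fun _ _ => abs_nonneg _)
      (Finset.mem_range.2 (Nat.lt_succ_of_le hk))
  refine (Set.finite_Icc (-R) R).subset ?_
  rintro _ ⟨n, rfl⟩
  refine ⟨fun i => ?_, fun i => ?_⟩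
  · obtain ⟨k, hk, h⟩ := hpast i (-1) (by simp) n
    have := abs_le.1 (hle k hk i)
    rw [Pi.neg_apply]
    linarith
  · obtain ⟨k, hk, h⟩ := hpast i 1 (by simp) n
    have := abs_le.1 (hle k hk i)
    linarith

variable {Ω : Type*} [MeasurableSpace Ω] {P : Measure Ω} [IsProbabilityMeasure P]
  {β : ℝ} {v : Fin d → ℤ} {X : ℕ → Ω → Fin d → ℤ}

/-- When the walk exceeds its past in a coordinate direction, a whole half-space lies unvisited in
front of it, and the walk is trapped in a unit square of that half-space with a probability that
does not depend on the past. -/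
theorem IsAntRW.ae_trapped_of_frequently_record (hX : IsAntRW (lattice d) β v P X) (hβ : 0 < β)
    (hd : 2 ≤ d) :
    ∀ᵐ ω ∂P, (∃ᶠ n in Filter.atTop, (fun k => X k ω) ∈ recordAt d n) →
      ω ∈ ⋃ C : Circuit (lattice d), trapped X C := by
  refine ae_mem_of_frequently (P := P) hX.measurable measurableSet_iUnion_trapped
    (E := recordAt d) (fun n p q hpq ⟨i, s, hs, h⟩ => ⟨i, s, hs, fun k hk => by
      rw [← hpq k hk.le, ← hpq n le_rfl]; exact h k hk⟩)
    (followBound_pos (β := β) (Finset.Icc (fun _ => -1 : Fin d → ℤ) fun _ => 1).card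
      (1 / (4 : ℕ)) ((0 : ℕ) + 3 * (0 : ℕ) + 1)) ?_
  rintro n q ⟨i, s, hs, hrec⟩
  have : Nontrivial (Fin d) := Fin.nontrivial_iff_two_le.2 hd
  obtain ⟨j, hji⟩ := exists_ne i
  set C := square (q n) hji.symm hs with hC
  have hlen : C.len = 4 := rfl
  have hroot : C.loop 0 = q n := square_loop_zero _ _ _
  have hpast : ∀ k < n, ∀ m, q k ≠ C.loop m := fun k hk m h => by
    have h1 := hrec k hk
    have h2 := le_mul_square_loop (q n) hji.symm hs m
    rw [← hC, ← h] at h2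
    omega
  have hfresh : ∀ m, C.loop m ≠ q n → ∀ k ≤ n, q k ≠ C.loop m := fun m hm k hk => by
    rcases hk.lt_or_eq with hk | rfl
    exacts [hpast k hk m, hm.symm]
  refine hX.followBound_mul_le_trapped hβ card_neighborFinset_lattice_le (w := C.loop) (k₀ := 0)
    hroot C.loop_adj le_rfl hlen.le (fun j => by rw [zero_add]) fun m y _ => ?_
  push_cast
  rw [sub_zero]
  by_cases hm : C.loop m = q n
  · -- The walk stands at the root, which it has just discovered: it has never left it.
    have hne : C.loop (m + 1) ≠ q n := fun h => (C.loop_adj m).ne (hm.trans h.symm)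
    rw [crossing_antisymm q n (C.loop (m + 1)), crossing_eq_zero (hfresh _ hne), neg_zero]
    exact crossing_nonpos (fun k hk => hpast k hk m) y
  · rw [crossing_eq_zero (hfresh m hm), crossing_eq_zero (hfresh m hm)]

end Lattice

end AntRW

end

theorem theorem2p1 {Ω : Type*} [MeasurableSpace Ω] (P : Measure Ω) [IsProbabilityMeasure P]
    (β : ℝ) (hβ : 0 < β) :
    (∀ (V : Type*) [Finite V] (G : SimpleGraph V) [G.LocallyFinite],
        G.Connected → ¬ G.IsTree →
        ∀ (v : V) (X : ℕ → Ω → V), AntRW.IsAntRW G β v P X →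
          P (⋃ C : AntRW.Circuit G, AntRW.trapped X C) = 1) ∧
    (∀ d : ℕ, 2 ≤ d →
        ∀ (v : Fin d → ℤ) (X : ℕ → Ω → (Fin d → ℤ)), AntRW.IsAntRW (AntRW.lattice d) β v P X →
          P (⋃ C : AntRW.Circuit (AntRW.lattice d), AntRW.trapped X C) = 1) := by
  constructor
  · intro V _ G _ hconn htree v X hX
    obtain ⟨C₀⟩ := AntRW.nonempty_circuit_of_not_isAcyclic fun h => htree ⟨hconn, h⟩
    have hmeas := iSup_le (AntRW.history_le hX.measurable) _
      (AntRW.measurableSet_iUnion_trapped (G := G) (X := X))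
    have := Fintype.ofFinite V
    rw [← mem_ae_iff_prob_eq_one hmeas]
    filter_upwards [hX.ae_trapped_of_finite_range hβ (fun x => Finset.card_le_univ _) hconn C₀]
      with ω hω
    exact hω (Set.toFinite _)
  · intro d hd v X hX
    have hmeas := iSup_le (AntRW.history_le hX.measurable) _
      (AntRW.measurableSet_iUnion_trapped (G := AntRW.lattice d) (X := X))
    have hij : (⟨0, by omega⟩ : Fin d) ≠ ⟨1, by omega⟩ := by simp
    rw [← mem_ae_iff_prob_eq_one hmeas]
    filter_upwards [hX.ae_trapped_of_finite_range hβ AntRW.card_neighborFinset_lattice_le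
      (AntRW.lattice_connected d) (AntRW.square 0 hij (s := 1) (by simp)),
      hX.ae_trapped_of_frequently_record hβ hd] with ω hfin hrec
    by_cases h : ∃ᶠ n in Filter.atTop, (fun k => X k ω) ∈ AntRW.recordAt d n
    · exact hrec h
    · exact hfin (AntRW.finite_range_of_eventually_not_record h)
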